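/- Fix real parameters $\eta>0$, $\alpha\ge 0$, $v^\star>0$, $\varphi,p^\star,q^\star,\omega_0,\omega_{\rm g},r_{\rm g},l_{\rm g},v_{\rm g}\in\mathbb R$ such that the grid impedance $z:=r_{\rm g}+j\omega_{\rm g}l_{\rm g}\in\mathbb C$ is nonzero, and put $y:=z^{-1}$, $\omega_\Delta:=\omega_0-\omega_{\rm g}$, and $\sigma+j\rho:=e^{j\varphi}\frac{p^\star-jq^\star}{v^{\star2}}$ with $\sigma,\rho\in\mathbb R$. Let $$J=\begin{bmatrix}0&-1\\1&0\end{bmatrix},\quad S=\begin{bmatrix}\sigma&-\rho\\ \rho&\sigma\end{bmatrix},\quad Y_\varphi=\begin{bmatrix}\cos\varphi&-\sin\varphi\\ \sin\varphi&\cos\varphi\end{bmatrix}\begin{bmatrix}r_{\rm g}&-\omega_{\rm g}l_{\rm g}\\ \omega_{\rm g}l_{\rm g}&r_{\rm g}\end{bmatrix}^{-1},\quad \mathbf v_{\rm g}=\begin{bmatrix}v_{\rm g}\\0\end{bmatrix},$$ and consider the reduced second-order system on $\mathbb R^2$ (Euclidean norm) $$\dot{\mathbf v}=\bigl[\omega_\Delta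 J+\eta(S-Y_\varphi)\bigr]\mathbf v+\eta Y_\varphi\mathbf v_{\rm g}+\eta\alpha\,\frac{v^{\star2}-\|\mathbf v\|^2}{v^{\star2}}\,\mathbf v .$$ Let $\mathbf v_{\rm s}\in\mathbb R^2$ be an equilibrium point of this system. If $$\operatorname{Re}\Bigl\{e^{j\varphi}\frac{p^\star-jq^\star}{v^{\star2}}\Bigr\}+\alpha<\frac{\alpha}{v^{\star2}}\|\mathbf v_{\rm s}\|^2+\operatorname{Re}\{e^{j\varphi}y\},$$ then $\mathbf v_{\rm s}$ is locally asymptotically stable: for every $\varepsilon>0$ there is $\delta>0$ such that from each initial state with $\|\mathbf v(0)-\mathbf v_{\rm s}\|<\delta$ a solution exists for all $t\ge0$, and every such solution satisfies $\|\mathbf v(t)-\mathbf v_{\rm s}\|<\varepsilon$ for all $t\ge 0$; and there is $\delta>0$ such that from each initial state with $\|\mathbf v(0)-\mathbf v_{\rm s}\|<\delta$ a solution exists for all $t\ge0$, and every such solution converges to $\mathbf v_{\rm s}$ as $t\to\infty$. -/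

import Mathlib

open Matrix

noncomputable section

/-- The plane `ℝ²` of `dq`-vectors, with the Euclidean norm. -/
abbrev Plane : Type := EuclideanSpace ℝ (Fin 2)

/-! ### Stability notions for an autonomous system `x' = f x` -/

/-- A forward solution of the autonomous system `x' = f x`, i.e. one defined for all `t ≥ 0`
(one-sided derivative at `t = 0`). -/
def IsForwardSolution (f : Plane → Plane) (x : ℝ → Plane) : Prop :=
  IsIntegralCurveOn x (fun _ => f) (Set.Ici 0)

def IsEquilibrium (f : Plane → Plane) (xs : Plane) : Prop := f xs = 0

/-- Lyapunov stability of `xs`: solutions that start close enough to `xs` exist for all `t ≥ 0`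
and stay in a prescribed neighbourhood of `xs`. -/
def IsLyapunovStable (f : Plane → Plane) (xs : Plane) : Prop :=
  ∀ ε > 0, ∃ δ > 0, ∀ x₀ : Plane, ‖x₀ - xs‖ < δ →
    (∃ x : ℝ → Plane, x 0 = x₀ ∧ IsForwardSolution f x) ∧
    ∀ x : ℝ → Plane, x 0 = x₀ → IsForwardSolution f x → ∀ t ≥ 0, ‖x t - xs‖ < ε

/-- Local attractivity of `xs`: solutions that start close enough to `xs` exist for all `t ≥ 0`
and converge to `xs`. -/
def IsLocallyAttractive (f : Plane → Plane) (xs : Plane) : Prop :=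
  ∃ δ > 0, ∀ x₀ : Plane, ‖x₀ - xs‖ < δ →
    (∃ x : ℝ → Plane, x 0 = x₀ ∧ IsForwardSolution f x) ∧
    ∀ x : ℝ → Plane, x 0 = x₀ → IsForwardSolution f x →
      Filter.Tendsto x Filter.atTop (nhds xs)

def IsLocallyAsymptoticallyStable (f : Plane → Plane) (xs : Plane) : Prop :=
  IsLyapunovStable f xs ∧ IsLocallyAttractive f xs

/-! ### The reduced second-order grid-connected converter system -/

/-- The parameters of the grid-connected converter under complex droop control. -/
structure ConverterParams where
  /-- power droop gain -/
  η : ℝ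
  /-- voltage droop gain -/
  α : ℝ
  /-- rotation angle -/
  φ : ℝ
  /-- active power setpoint -/
  pStar : ℝ
  /-- reactive power setpoint -/
  qStar : ℝ
  /-- voltage setpoint -/
  vStar : ℝ
  /-- nominal angular frequency of the converter -/
  ω₀ : ℝ
  /-- grid angular frequency -/
  ωg : ℝ
  /-- grid resistance -/
  rg : ℝ
  /-- grid inductance -/
  lg : ℝ
  /-- grid voltage amplitude -/
  vg : ℝ

namespace ConverterParams

variable (P : ConverterParams)

/-- Complex grid impedance `z = r_g + j ω_g l_g`. -/
def z : ℂ := (P.rg : ℂ) + Complex.I * ((P.ωg * P.lg : ℝ) : ℂ)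

/-- Complex grid admittance `y = z⁻¹`. -/
def y : ℂ := P.z⁻¹

/-- The rotated, conjugated and normalized power setpoint
`e^{jφ} (p⋆ - j q⋆) / v⋆² = σ_φ⋆ + j ρ_φ⋆`. -/
def rotatedSetpoint : ℂ :=
  Complex.exp (Complex.I * (P.φ : ℂ)) *
    (((P.pStar : ℂ) - Complex.I * (P.qStar : ℂ)) / (P.vStar : ℂ) ^ 2)

/-- Frequency mismatch `ω_Δ = ω₀ - ω_g`. -/
def ωΔ : ℝ := P.ω₀ - P.ωg

/-- The matrix `J` (rotation by a quarter turn). -/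
def rotJ : Matrix (Fin 2) (Fin 2) ℝ := !![0, -1; 1, 0]

/-- The rotation matrix `R_φ`. -/
def R : Matrix (Fin 2) (Fin 2) ℝ :=
  !![Real.cos P.φ, -Real.sin P.φ; Real.sin P.φ, Real.cos P.φ]

/-- The impedance matrix `Z`. -/
def Z : Matrix (Fin 2) (Fin 2) ℝ :=
  !![P.rg, -(P.ωg * P.lg); P.ωg * P.lg, P.rg]

/-- The admittance matrix `Y = Z⁻¹`. -/
def Y : Matrix (Fin 2) (Fin 2) ℝ := P.Z⁻¹

/-- The rotated admittance matrix `Y_φ = R_φ Y`. -/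
def Yφ : Matrix (Fin 2) (Fin 2) ℝ := P.R * P.Y

/-- The matrix `S_φ⋆` of the rotated power setpoint, with `σ_φ⋆`, `ρ_φ⋆` the real and imaginary
parts of `e^{jφ} (p⋆ - j q⋆) / v⋆²`. -/
def S : Matrix (Fin 2) (Fin 2) ℝ :=
  !![P.rotatedSetpoint.re, -P.rotatedSetpoint.im; P.rotatedSetpoint.im, P.rotatedSetpoint.re]

/-- The voltage regulation matrix `Φ(v) = ((v⋆² - ‖v‖²) / v⋆²) I₂`. -/
def Φ (v : Plane) : Matrix (Fin 2) (Fin 2) ℝ :=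
  ((P.vStar ^ 2 - ‖v‖ ^ 2) / P.vStar ^ 2) • (1 : Matrix (Fin 2) (Fin 2) ℝ)

/-- The grid voltage vector `[v_g, 0]ᵀ` in the grid synchronous frame. -/
def vgVec : Fin 2 → ℝ := ![P.vg, 0]

/-- Right-hand side of the reduced second-order system
`v' = [ω_Δ J + η (S_φ⋆ - Y_φ)] v + η Y_φ v_g + η α Φ(v) v`. -/
def reducedField (v : Plane) : Plane :=
  WithLp.toLp 2
    ((P.ωΔ • rotJ + P.η • (P.S - P.Yφ)) *ᵥ v.ofLp
      + P.η • (P.Yφ *ᵥ P.vgVec)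
      + (P.η * P.α) • (P.Φ v *ᵥ v.ofLp))

end ConverterParams

end

/-!
The matrices of the reduced system represent multiplication by complex numbers, and multiplication
by `a` satisfies `⟪w, a w⟫ = Re a * ‖w‖ ^ 2`, so the linear part acts on the squared distance to the
equilibrium `vs` only through a real part. Completing a square, the contribution of the cubic
voltage regulation term is at most `-(η α / v⋆²) * ‖vs‖ ^ 2 * ‖v - vs‖ ^ 2`, up to an error of order
`‖v - vs‖ ^ 4`. Under the stability condition `‖v - vs‖ ^ 2` is therefore a strict Lyapunov function
near `vs`. Small balls around `vs` are then forward invariant, so cutting the field off outside a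
ball does not affect solutions starting in it, which makes them global, and Grönwall's inequality
gives exponential convergence.
-/

open Filter Metric Set
open scoped InnerProductSpace Manifold Topology

section CompactSupport

variable {E : Type*} [NormedAddCommGroup E] [NormedSpace ℝ E]

theorem exists_contDiff_hasCompactSupport_eqOn_closedBall [FiniteDimensional ℝ E]
    {G : Type*} [NormedAddCommGroup G] [NormedSpace ℝ G] {n : ℕ∞} {F : E → G}
    (hF : ContDiff ℝ n F) (x : E) {r : ℝ} (hr : 0 < r) :
    ∃ g : E → G, ContDiff ℝ n g ∧ HasCompactSupport g ∧ EqOn g F (closedBall x r) := by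
  let b : ContDiffBump x := ⟨r, r + 1, hr, lt_add_one r⟩
  refine ⟨fun v => b v • F v, b.contDiff.smul hF, b.hasCompactSupport.smul_right, fun v hv => ?_⟩
  dsimp only
  rw [b.one_of_mem_closedBall hv, one_smul]

theorem exists_isIntegralCurve_of_hasCompactSupport [CompleteSpace E] {g : E → E}
    (hg : ContDiff ℝ 1 g) (hsupp : HasCompactSupport g) (x₀ : E) :
    ∃ x : ℝ → E, x 0 = x₀ ∧ IsIntegralCurve x (fun _ => g) := by
  obtain ⟨K, hK⟩ : ∃ K, LipschitzWith K g := hg.lipschitzWith_of_hasCompactSupport hsupp one_ne_zero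
  obtain ⟨C, hC⟩ := hsupp.exists_bound_of_continuous hg.continuous
  -- A bounded field admits Picard–Lindelöf time steps independent of the starting point.
  have picard (x : E) : IsPicardLindelof (fun _ => g) (⟨0, by simp⟩ : Icc (-1 : ℝ) 1) x
      C.toNNReal 0 C.toNNReal K :=
    .of_time_independent (fun v _ => (hC v).trans C.le_coe_toNNReal) hK.lipschitzOnWith (by simp)
  have local_curve (x : E) :
      ∃ γ : ℝ → E, γ 0 = x ∧ IsMIntegralCurveOn (I := 𝓘(ℝ, E)) γ g (Ioo (-1) 1) := by
    obtain ⟨γ, hγ₀, hγ⟩ := (picard x).exists_eq_forall_mem_Icc_hasDerivWithinAt₀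
    refine ⟨γ, hγ₀, fun t ht => ?_⟩
    have deriv := (hγ t (Ioo_subset_Icc_self ht)).mono Ioo_subset_Icc_self
    exact deriv.hasFDerivWithinAt.hasMFDerivWithinAt
  obtain ⟨x, hx₀, hx⟩ := exists_isMIntegralCurve_of_isMIntegralCurveOn
    (contMDiff_vectorSpace_iff_contDiff.2 hg) one_pos local_curve x₀
  exact ⟨x, hx₀, fun t => hasDerivAt_iff_hasFDerivAt.2 (hx t).hasFDerivAt⟩

end CompactSupport

section RadiallyDissipative

variable {E : Type*} [NormedAddCommGroup E] [InnerProductSpace ℝ E]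

/-- On the closed ball of radius `r` around `xs`, the vector field `F` points towards `xs` with
strength at least `c` times the distance to `xs`; equivalently, `‖v - xs‖ ^ 2` is a Lyapunov
function there, decaying at rate `2 * c`. -/
def IsRadiallyDissipative (F : E → E) (xs : E) (c r : ℝ) : Prop :=
  ∀ v ∈ closedBall xs r, ⟪v - xs, F v⟫_ℝ ≤ -c * ‖v - xs‖ ^ 2

theorem hasDerivWithinAt_norm_sub_sq {F : E → E} {x : ℝ → E} {s : Set ℝ}
    (hx : IsIntegralCurveOn x (fun _ => F) s) (xs : E) {t : ℝ} (ht : t ∈ s) :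
    HasDerivWithinAt (fun τ => ‖x τ - xs‖ ^ 2) (2 * ⟪x t - xs, F (x t)⟫_ℝ) s t :=
  ((hx t ht).sub_const xs).norm_sq

namespace IsRadiallyDissipative

variable {F : E → E} {xs : E} {c r : ℝ} {x : ℝ → E}

theorem congr {g : E → E} (hF : IsRadiallyDissipative F xs c r)
    (hg : EqOn g F (closedBall xs r)) : IsRadiallyDissipative g xs c r := fun v hv => by
  rw [hg hv]
  exact hF v hv

theorem mapsTo_closedBall (hF : IsRadiallyDissipative F xs c r) (hc : 0 < c) (hr : 0 < r)
    (hx : IsIntegralCurveOn x (fun _ => F) (Ici 0)) (hx₀ : x 0 ∈ closedBall xs r) :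
    MapsTo x (Ici 0) (closedBall xs r) := by
  intro t ht
  have deriv {s : ℝ} (hs : 0 ≤ s) := hasDerivWithinAt_norm_sub_sq hx xs hs
  have inward (s : ℝ) (hsr : ‖x s - xs‖ ^ 2 = r ^ 2) : 2 * ⟪x s - xs, F (x s)⟫_ℝ < 0 := by
    have hs : x s ∈ closedBall xs r :=
      mem_closedBall_iff_norm.2 (le_of_sq_le_sq hsr.le hr.le)
    have decay := hF (x s) hs
    rw [hsr] at decay
    linarith [mul_pos hc (pow_pos hr 2)]
  have barrier : ‖x t - xs‖ ^ 2 ≤ r ^ 2 :=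
    image_le_of_deriv_right_lt_deriv_boundary (B := fun _ => r ^ 2) (B' := fun _ => 0)
      (fun s hs => (deriv hs.1).continuousWithinAt.mono Icc_subset_Ici_self)
      (fun s hs => (deriv hs.1).mono (Ici_subset_Ici.2 hs.1))
      (pow_le_pow_left₀ (norm_nonneg _) (mem_closedBall_iff_norm.1 hx₀) 2)
      (fun _ => hasDerivAt_const _ _) (fun s _ => inward s) ⟨ht, le_rfl⟩
  exact mem_closedBall_iff_norm.2 (le_of_sq_le_sq barrier hr.le)

theorem norm_sub_le_mul_exp (hF : IsRadiallyDissipative F xs c r) (hc : 0 < c) (hr : 0 < r)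
    (hx : IsIntegralCurveOn x (fun _ => F) (Ici 0)) (hx₀ : x 0 ∈ closedBall xs r)
    {t : ℝ} (ht : 0 ≤ t) : ‖x t - xs‖ ≤ ‖x 0 - xs‖ * Real.exp (-c * t) := by
  have deriv {s : ℝ} (hs : 0 ≤ s) := hasDerivWithinAt_norm_sub_sq hx xs hs
  have gronwall : ‖x t - xs‖ ^ 2 ≤ gronwallBound (‖x 0 - xs‖ ^ 2) (-2 * c) 0 (t - 0) :=
    le_gronwallBound_of_liminf_deriv_right_le
      (fun s hs => (deriv hs.1).continuousWithinAt.mono Icc_subset_Ici_self)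
      (fun s hs _ => ((deriv hs.1).mono (Ici_subset_Ici.2 hs.1)).liminf_right_slope_le)
      le_rfl
      (fun s hs => by linarith [hF (x s) (hF.mapsTo_closedBall hc hr hx hx₀ hs.1)])
      t ⟨ht, le_rfl⟩
  refine le_of_sq_le_sq ?_ (by positivity)
  calc ‖x t - xs‖ ^ 2 ≤ ‖x 0 - xs‖ ^ 2 * Real.exp (-2 * c * t) := by
        simpa only [gronwallBound_ε0, sub_zero] using gronwall
    _ = (‖x 0 - xs‖ * Real.exp (-c * t)) ^ 2 := by
        rw [mul_pow, ← Real.exp_nat_mul]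
        congr 2
        push_cast
        ring

theorem exists_isIntegralCurveOn_Ici [FiniteDimensional ℝ E]
    (hF : IsRadiallyDissipative F xs c r) (hFd : ContDiff ℝ 1 F) (hc : 0 < c) (hr : 0 < r)
    {x₀ : E} (hx₀ : x₀ ∈ closedBall xs r) :
    ∃ x : ℝ → E, x 0 = x₀ ∧ IsIntegralCurveOn x (fun _ => F) (Ici 0) := by
  obtain ⟨g, hgd, hg_supp, hgF⟩ := exists_contDiff_hasCompactSupport_eqOn_closedBall hFd xs hr
  obtain ⟨x, rfl, hx⟩ := exists_isIntegralCurve_of_hasCompactSupport hgd hg_supp x₀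
  refine ⟨x, rfl, fun t ht => ?_⟩
  have hxt : x t ∈ closedBall xs r :=
    (hF.congr hgF).mapsTo_closedBall hc hr (hx.isIntegralCurveOn _) hx₀ ht
  exact (hx t).hasDerivWithinAt.congr_deriv (hgF hxt)

end IsRadiallyDissipative

end RadiallyDissipative

theorem isLocallyAsymptoticallyStable_of_eventually_inner_le {F : Plane → Plane}
    (hFd : ContDiff ℝ 1 F) {xs : Plane} {c : ℝ} (hc : 0 < c)
    (hF : ∀ᶠ v in 𝓝 xs, ⟪v - xs, F v⟫_ℝ ≤ -c * ‖v - xs‖ ^ 2) :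
    IsLocallyAsymptoticallyStable F xs := by
  obtain ⟨r, hr, hFr⟩ : ∃ r > 0, IsRadiallyDissipative F xs c r :=
    nhds_basis_closedBall.eventually_iff.1 hF
  have mem_ball {x₀ : Plane} (hx₀ : ‖x₀ - xs‖ < r) : x₀ ∈ closedBall xs r :=
    mem_closedBall_iff_norm.2 hx₀.le
  refine ⟨fun ε hε => ⟨min ε r, lt_min hε hr, fun x₀ hx₀ => ?_⟩, r, hr, fun x₀ hx₀ => ?_⟩
  · obtain ⟨hx₀ε, hx₀r⟩ := lt_min_iff.1 hx₀
    refine ⟨hFr.exists_isIntegralCurveOn_Ici hFd hc hr (mem_ball hx₀r), ?_⟩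
    rintro x rfl hx t ht
    calc ‖x t - xs‖ ≤ ‖x 0 - xs‖ * Real.exp (-c * t) :=
          hFr.norm_sub_le_mul_exp hc hr hx (mem_ball hx₀r) ht
      _ ≤ ‖x 0 - xs‖ := mul_le_of_le_one_right (norm_nonneg _)
          (Real.exp_le_one_iff.2 (mul_nonpos_of_nonpos_of_nonneg (neg_nonpos.2 hc.le) ht))
      _ < ε := hx₀ε
  · refine ⟨hFr.exists_isIntegralCurveOn_Ici hFd hc hr (mem_ball hx₀), ?_⟩
    rintro x rfl hx
    have exp_decay : Tendsto (fun t => ‖x 0 - xs‖ * Real.exp (-c * t)) atTop (𝓝 0) := by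
      simpa only [mul_zero, Function.comp_def, id] using (Real.tendsto_exp_atBot.comp
        (tendsto_id.const_mul_atTop_of_neg (neg_lt_zero.2 hc))).const_mul ‖x 0 - xs‖
    refine tendsto_iff_norm_sub_tendsto_zero.2 (squeeze_zero' (.of_forall fun _ => norm_nonneg _)
      ?_ exp_decay)
    filter_upwards [eventually_ge_atTop 0] with t ht
    exact hFr.norm_sub_le_mul_exp hc hr hx (mem_ball hx₀) ht

theorem eventually_neg_mul_add_mul_norm_sub_pow_four_le {E : Type*} [SeminormedAddCommGroup E]
    {c d : ℝ} (hcd : c < d) (k : ℝ) (xs : E) :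
    ∀ᶠ v in 𝓝 xs, -d * ‖v - xs‖ ^ 2 + k * ‖v - xs‖ ^ 4 ≤ -c * ‖v - xs‖ ^ 2 := by
  have small : ∀ᶠ v in 𝓝 xs, k * ‖v - xs‖ ^ 2 < d - c := by
    have cont : Continuous fun v => k * ‖v - xs‖ ^ 2 := by fun_prop
    exact cont.continuousAt.eventually_lt_const (by simpa using hcd)
  filter_upwards [small] with v hv
  linear_combination mul_le_mul_of_nonneg_right hv.le (sq_nonneg ‖v - xs‖)

theorem norm_sq_mul_sub_le_inner_sub_norm_sq_smul_sub {E : Type*} [NormedAddCommGroup E]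
    [InnerProductSpace ℝ E] (u v : E) :
    ‖u‖ ^ 2 * ‖v - u‖ ^ 2 - ‖v - u‖ ^ 4 / 8 ≤ ⟪v - u, ‖v‖ ^ 2 • v - ‖u‖ ^ 2 • u⟫_ℝ := by
  obtain ⟨w, rfl⟩ : ∃ w, v = u + w := ⟨v - u, (add_sub_cancel u v).symm⟩
  have expand : ⟪w, ‖u + w‖ ^ 2 • (u + w) - ‖u‖ ^ 2 • u⟫_ℝ =
      ‖u‖ ^ 2 * ‖w‖ ^ 2 - ‖w‖ ^ 4 / 8 + 2 * (⟪u, w⟫_ℝ + 3 / 4 * ‖w‖ ^ 2) ^ 2 := by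
    rw [norm_add_sq_real, inner_sub_right, inner_smul_right, inner_smul_right, inner_add_right,
      real_inner_self_eq_norm_sq, real_inner_comm w u]
    ring
  rw [add_sub_cancel_left, expand]
  exact le_add_of_nonneg_right (by positivity)

theorem leftMulMatrix_inv {R S ι : Type*} [CommRing R] [DivisionRing S] [Algebra R S] [Fintype ι]
    [DecidableEq ι] (b : Module.Basis ι R S) {a : S} (ha : a ≠ 0) :
    (Algebra.leftMulMatrix b a)⁻¹ = Algebra.leftMulMatrix b a⁻¹ :=
  Matrix.inv_eq_right_inv (by rw [← map_mul, mul_inv_cancel₀ ha, map_one])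

theorem inner_toEuclideanCLM_leftMulMatrix_complex (a : ℂ) (w : EuclideanSpace ℝ (Fin 2)) :
    ⟪w, toEuclideanCLM (𝕜 := ℝ) (Algebra.leftMulMatrix Complex.basisOneI a) w⟫_ℝ =
      a.re * ‖w‖ ^ 2 := by
  rw [Matrix.inner_toEuclideanCLM, Algebra.leftMulMatrix_complex, EuclideanSpace.real_norm_sq_eq]
  simp only [dotProduct, Matrix.mulVec, Fin.sum_univ_two, Matrix.of_apply, Matrix.cons_val]
  ring

namespace ConverterParams

variable (P : ConverterParams)

/-- The rotated complex admittance `e^{jφ} y`, the complex number represented by `Y_φ`. -/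
noncomputable def rotatedAdmittance : ℂ := Complex.exp (Complex.I * (P.φ : ℂ)) * P.y

/-- The matrix of the linear part of the reduced system, voltage regulation excluded. -/
noncomputable def linearPart : Matrix (Fin 2) (Fin 2) ℝ := P.ωΔ • rotJ + P.η • (P.S - P.Yφ)

/-- The gap between the two sides of the stability condition at the state `vs`. -/
noncomputable def stabilityMargin (vs : Plane) : ℝ :=
  P.α / P.vStar ^ 2 * ‖vs‖ ^ 2 + P.rotatedAdmittance.re - (P.rotatedSetpoint.re + P.α)

theorem R_eq_leftMulMatrix :
    P.R = Algebra.leftMulMatrix Complex.basisOneI (Complex.exp (Complex.I * (P.φ : ℂ))) := by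
  rw [Algebra.leftMulMatrix_complex, mul_comm, Complex.exp_ofReal_mul_I_re,
    Complex.exp_ofReal_mul_I_im, R]

theorem Z_eq_leftMulMatrix : P.Z = Algebra.leftMulMatrix Complex.basisOneI P.z := by
  rw [Algebra.leftMulMatrix_complex]
  simp [Z, z]

theorem Yφ_eq_leftMulMatrix (hz : P.z ≠ 0) :
    P.Yφ = Algebra.leftMulMatrix Complex.basisOneI P.rotatedAdmittance := by
  rw [Yφ, Y, R_eq_leftMulMatrix, Z_eq_leftMulMatrix, leftMulMatrix_inv _ hz, ← map_mul,
    rotatedAdmittance, y]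

theorem linearPart_eq_leftMulMatrix (hz : P.z ≠ 0) :
    P.linearPart = Algebra.leftMulMatrix Complex.basisOneI
      (P.ωΔ • Complex.I + P.η • (P.rotatedSetpoint - P.rotatedAdmittance)) := by
  have rotJ_eq : rotJ = Algebra.leftMulMatrix Complex.basisOneI Complex.I := by
    simp [Algebra.leftMulMatrix_complex, rotJ]
  have S_eq : P.S = Algebra.leftMulMatrix Complex.basisOneI P.rotatedSetpoint :=
    (Algebra.leftMulMatrix_complex _).symm
  rw [linearPart, rotJ_eq, S_eq, Yφ_eq_leftMulMatrix P hz, map_add, map_smul, map_smul, map_sub]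

theorem inner_linearPart_self (hz : P.z ≠ 0) (w : Plane) :
    ⟪w, toEuclideanCLM (𝕜 := ℝ) P.linearPart w⟫_ℝ =
      P.η * (P.rotatedSetpoint.re - P.rotatedAdmittance.re) * ‖w‖ ^ 2 := by
  rw [linearPart_eq_leftMulMatrix P hz, inner_toEuclideanCLM_leftMulMatrix_complex]
  simp

theorem reducedField_eq (v : Plane) :
    P.reducedField v = toEuclideanCLM (𝕜 := ℝ) P.linearPart v
      + P.η • WithLp.toLp 2 (P.Yφ *ᵥ P.vgVec)
      + (P.η * P.α * ((P.vStar ^ 2 - ‖v‖ ^ 2) / P.vStar ^ 2)) • v := by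
  simp only [reducedField, linearPart, Φ, Matrix.smul_mulVec, Matrix.one_mulVec, smul_smul]
  rfl

theorem contDiff_reducedField {n : WithTop ℕ∞} : ContDiff ℝ n P.reducedField := by
  rw [funext P.reducedField_eq]
  have norm_sq : ContDiff ℝ n fun v : Plane => ‖v‖ ^ 2 := contDiff_norm_sq ℝ
  fun_prop

theorem reducedField_sub (hvStar : P.vStar ≠ 0) (u v : Plane) :
    P.reducedField v - P.reducedField u =
      toEuclideanCLM (𝕜 := ℝ) P.linearPart (v - u) + (P.η * P.α) • (v - u)
        - (P.η * P.α / P.vStar ^ 2) • (‖v‖ ^ 2 • v - ‖u‖ ^ 2 • u) := by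
  have regulation (w : Plane) : P.η * P.α * ((P.vStar ^ 2 - ‖w‖ ^ 2) / P.vStar ^ 2) =
      P.η * P.α - P.η * P.α / P.vStar ^ 2 * ‖w‖ ^ 2 := by
    field_simp
  rw [reducedField_eq, reducedField_eq, regulation, regulation, map_sub]
  module

theorem inner_sub_reducedField_sub_le (hη : 0 ≤ P.η) (hα : 0 ≤ P.α) (hvStar : P.vStar ≠ 0)
    (hz : P.z ≠ 0) (u v : Plane) :
    ⟪v - u, P.reducedField v - P.reducedField u⟫_ℝ ≤
      -(P.η * P.stabilityMargin u) * ‖v - u‖ ^ 2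
        + P.η * P.α / P.vStar ^ 2 / 8 * ‖v - u‖ ^ 4 := by
  have cubic := mul_le_mul_of_nonneg_left (norm_sq_mul_sub_le_inner_sub_norm_sq_smul_sub u v)
    (show 0 ≤ P.η * P.α / P.vStar ^ 2 by positivity)
  rw [P.reducedField_sub hvStar, inner_sub_right, inner_add_right, P.inner_linearPart_self hz,
    inner_smul_right, inner_smul_right, real_inner_self_eq_norm_sq, stabilityMargin]
  linear_combination cubic

end ConverterParams

theorem mainTheorem8 (P : ConverterParams)
    (hη : 0 < P.η) (hα : 0 ≤ P.α) (hvStar : 0 < P.vStar) (hz : P.z ≠ 0)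
    (vs : Plane) (hvs : IsEquilibrium P.reducedField vs)
    (hcond :
      (Complex.exp (Complex.I * (P.φ : ℂ)) *
          (((P.pStar : ℂ) - Complex.I * (P.qStar : ℂ)) / (P.vStar : ℂ) ^ 2)).re + P.α
        < P.α / P.vStar ^ 2 * ‖vs‖ ^ 2
          + (Complex.exp (Complex.I * (P.φ : ℂ)) * P.y).re) :
    IsLocallyAsymptoticallyStable P.reducedField vs := by
  have rate_pos : 0 < P.η * P.stabilityMargin vs := mul_pos hη (sub_pos.2 hcond)
  refine isLocallyAsymptoticallyStable_of_eventually_inner_le P.contDiff_reducedField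
    (half_pos rate_pos) ?_
  filter_upwards [eventually_neg_mul_add_mul_norm_sub_pow_four_le (half_lt_self rate_pos)
    (P.η * P.α / P.vStar ^ 2 / 8) vs] with v hv
  have decay := P.inner_sub_reducedField_sub_le hη.le hα hvStar.ne' hz vs v
  rw [show P.reducedField vs = 0 from hvs, sub_zero] at decay
  exact decay.trans hv
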